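/- Let $X$ be an infinite-dimensional complex Banach space and $T$ a bounded linear operator on $X$, with spectrum $\sigma(T)$ and Banach-space dual $T^*:X^*\to X^*$; write $N(\cdot)$ and $R(\cdot)$ for null space and range. - A bounded operator $S$ on $X$ is Weyl if $R(S)$ is closed and $\dim N(S)=\operatorname{codim}R(S)<\infty$ (that is, $S$ is Fredholm of index $0$). The Weyl spectrum is $\sigma_W(T)=\{\lambda\in\mathbb C: T-\lambda I \text{ is not Weyl}\}$, and $\sigma_W(T)^C=\mathbb C\setminus\sigma_W(T)$. - The ascent and the descent of $S$ are $a(S)=\inf\{n\ge 0: N(S^n)=N(S^{n+1})\}$ and $\delta(S)=\inf\{n\ge 0: R(S^n)=R(S^{n+1})\}$, with $\inf\emptyset=\infty$. - $\Pi^0(T)$ is the set of poles of finite rank of $T$: those $\lambda\in\sigma(T)$ with $p:=a(T-\lambda I)<\infty$, $\delta(T-\lambda I)<\infty$ and $\dim N((T-\lambda I)^{p})<\infty$. - $\sigma_a(T)$ is the approximate point spectrum, i.e. the set of $\lambda\in\mathbb C$ such that $T-\lambda I$ is not bounded below. $\Pi_a(T)$ is the set of left poles of $T$: those $\lambda\in\sigma_a(T)$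 with $a(T-\lambda I)<\infty$ and $R\big((T-\lambda I)^{a(T-\lambda I)+1}\big)$ closed. - $T$ satisfies property $(Z_{\Pi_a})$ if $\sigma(T)\setminus\sigma_W(T)=\Pi_a(T)$. - A bounded operator $S$ on a complex Banach space $Y$ has the single-valued extension property (SVEP) at $\lambda\in\mathbb C$ if, for every open disc $D$ centred at $\lambda$, the only analytic function $f:D\to Y$ with $(S-\mu I)f(\mu)=0$ for all $\mu\in D$ is $f\equiv 0$. It has SVEP on $A\subset\mathbb C$ if it has SVEP at every point of $A$. **Proposition.** If $T$ or $T^*$ has SVEP on $\sigma_W(T)^C$, then $T$ satisfies property $(Z_{\Pi_a})$ if and only if $\Pi_a(T)=\Pi^0(T)$. -/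

import Mathlib

namespace WeylType

section

variable {X : Type*} [NormedAddCommGroup X] [NormedSpace ℂ X]

/-- The operator `T - z I`. -/
def shift (T : X →L[ℂ] X) (z : ℂ) : X →L[ℂ] X := T - z • ContinuousLinearMap.id ℂ X

/-- The Banach space dual `T* : X* → X*`, `T* φ = φ ∘ T` (complex linear in `T`). -/
noncomputable def dual (T : X →L[ℂ] X) : StrongDual ℂ X →L[ℂ] StrongDual ℂ X :=
  ContinuousLinearMap.precomp ℂ T

/-- A Weyl operator: Fredholm (closed range of finite codimension, finite-dimensional kernel)
with index `dim N(T) - codim R(T)` equal to `0`. -/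
def IsWeyl (T : X →L[ℂ] X) : Prop :=
  T.IsFredholm ∧ (T : X →ₗ[ℂ] X).index = 0

/-- The Weyl spectrum `σ_W(T)`. -/
def weylSpectrum (T : X →L[ℂ] X) : Set ℂ := {z | ¬ IsWeyl (shift T z)}

/-- The approximate point spectrum `σ_a(T)`: those `z` for which `T - z I` is not
bounded below. -/
def approxPointSpectrum (T : X →L[ℂ] X) : Set ℂ :=
  {z | ¬ ∃ c : ℝ, 0 < c ∧ ∀ x : X, c * ‖x‖ ≤ ‖shift T z x‖}

/-- The ascent `inf {n : N(Tⁿ) = N(Tⁿ⁺¹)}`, with `inf ∅ = ∞`. -/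
noncomputable def ascent (T : X →L[ℂ] X) : ℕ∞ :=
  ⨅ (n : ℕ) (_ : (T ^ n).ker = (T ^ (n + 1)).ker), (n : ℕ∞)

/-- The descent `inf {n : R(Tⁿ) = R(Tⁿ⁺¹)}`, with `inf ∅ = ∞`. -/
noncomputable def descent (T : X →L[ℂ] X) : ℕ∞ :=
  ⨅ (n : ℕ) (_ : (T ^ n).range = (T ^ (n + 1)).range), (n : ℕ∞)

/-- The set `Π(T)` of poles of the resolvent of `T`. -/
def poles (T : X →L[ℂ] X) : Set ℂ :=
  {z | z ∈ spectrum ℂ T ∧ ascent (shift T z) < ⊤ ∧ descent (shift T z) < ⊤}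

/-- The set `Π⁰(T)` of poles of finite rank. At a pole `z` of order `p = a(T - z I)` the spectral
projection has range `N((T - z I)ᵖ)`; its dimension is the rank of the pole. -/
def finiteRankPoles (T : X →L[ℂ] X) : Set ℂ :=
  {z | z ∈ poles T ∧
    FiniteDimensional ℂ (shift T z ^ (ascent (shift T z)).toNat).ker}

/-- The set `Π_a(T)` of left poles of `T`. -/
def leftPoles (T : X →L[ℂ] X) : Set ℂ :=
  {z | z ∈ approxPointSpectrum T ∧ ascent (shift T z) < ⊤ ∧
    IsClosed ((shift T z ^ ((ascent (shift T z)).toNat + 1)).range : Set X)}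

/-- Property `(Z_{Π_a})`: `σ(T) \ σ_W(T) = Π_a(T)`. -/
def PropertyZPi (T : X →L[ℂ] X) : Prop :=
  spectrum ℂ T \ weylSpectrum T = leftPoles T

/-- The single-valued extension property at `z`: on every open disc `D` centred at `z`, the only
analytic solution of `(T - w I) f(w) = 0` (`w ∈ D`) is `f = 0`. -/
def HasSVEPAt (T : X →L[ℂ] X) (z : ℂ) : Prop :=
  ∀ r : ℝ, 0 < r → ∀ f : ℂ → X, AnalyticOnNhd ℂ f (Metric.ball z r) →
    (∀ w ∈ Metric.ball z r, shift T w (f w) = 0) → ∀ w ∈ Metric.ball z r, f w = 0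

/-- SVEP at every point of `A`. -/
def HasSVEPOn (T : X →L[ℂ] X) (A : Set ℂ) : Prop := ∀ z ∈ A, HasSVEPAt T z

end

end WeylType

/-! Under either SVEP hypothesis `σ(T) \ σ_W(T) = Π⁰(T)`, and the equivalence is then a rewriting.
Write `S = T - zI`. At a finite-rank pole, with no SVEP needed, some `Sⁿ`, `n > 0`, has a
finite-dimensional kernel complementary to its range. So `Sⁿ` is Fredholm of index `0`, and hence so
is `S` (`isWeyl_of_stable`). Conversely, let `S` be Weyl. All powers have index `0`, so kernels and
ranges of powers stabilise together. SVEP of `T` bounds the ascent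
(`exists_ker_pow_eq_of_hasSVEPAt`): a nonzero kernel vector in the hyperrange would start a backward
orbit, whose power series violates SVEP. SVEP of `T*` bounds the ascent of `S*`, hence the descent
of `S`. -/

namespace WeylType

open LinearMap.FiniteRangeSetoid

/-! ### Stabilisation of kernels and ranges of powers -/

section Algebra

variable {X : Type*} [NormedAddCommGroup X] [NormedSpace ℂ X]

theorem pow_succ_apply' (S : X →L[ℂ] X) (n : ℕ) (x : X) : (S ^ (n + 1)) x = S ((S ^ n) x) := by
  rw [pow_succ']; rfl

theorem pow_succ_apply (S : X →L[ℂ] X) (n : ℕ) (x : X) : (S ^ (n + 1)) x = (S ^ n) (S x) := by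
  rw [pow_succ]; rfl

theorem pow_add_apply (S : X →L[ℂ] X) (m n : ℕ) (x : X) :
    (S ^ (m + n)) x = (S ^ m) ((S ^ n) x) := by
  rw [pow_add]; rfl

theorem range_pow_antitone (S : X →L[ℂ] X) {m n : ℕ} (h : m ≤ n) :
    (S ^ n).range ≤ (S ^ m).range := by
  rintro _ ⟨x, rfl⟩
  obtain ⟨k, rfl⟩ := Nat.exists_eq_add_of_le h
  exact ⟨(S ^ k) x, (pow_add_apply S m k x).symm⟩

theorem ascent_lt_top_iff (S : X →L[ℂ] X) :
    ascent S < ⊤ ↔ ∃ n : ℕ, (S ^ n).ker = (S ^ (n + 1)).ker := by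
  simp [ascent, iInf_lt_iff]

theorem descent_lt_top_iff (S : X →L[ℂ] X) :
    descent S < ⊤ ↔ ∃ n : ℕ, (S ^ n).range = (S ^ (n + 1)).range := by
  simp [descent, iInf_lt_iff]

theorem ker_pow_ascent {S : X →L[ℂ] X} (h : ascent S < ⊤) :
    (S ^ (ascent S).toNat).ker = (S ^ ((ascent S).toNat + 1)).ker := by
  classical
  have hex := (ascent_lt_top_iff S).1 h
  have heq : ascent S = (Nat.find hex : ℕ∞) := by
    refine le_antisymm (iInf_le_of_le _ (iInf_le _ (Nat.find_spec hex))) (le_iInf₂ fun n hn => ?_)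
    exact_mod_cast Nat.find_min' hex hn
  rw [heq, ENat.toNat_natCast]
  exact Nat.find_spec hex

theorem ker_pow_eq_of_le {S : X →L[ℂ] X} {p n : ℕ} (h : (S ^ p).ker = (S ^ (p + 1)).ker)
    (hn : p ≤ n) : (S ^ n).ker = (S ^ p).ker := by
  induction n, hn using Nat.le_induction with
  | base => rfl
  | succ n hn ih =>
    rw [h]
    ext x
    have h1 : S x ∈ (S ^ n).ker ↔ S x ∈ (S ^ p).ker := by rw [ih]
    rw [LinearMap.mem_ker, LinearMap.mem_ker] at h1 ⊢
    change (S ^ (n + 1)) x = 0 ↔ (S ^ (p + 1)) x = 0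
    rw [pow_succ_apply, pow_succ_apply]
    exact h1

theorem range_pow_eq_of_le {S : X →L[ℂ] X} {p n : ℕ} (h : (S ^ p).range = (S ^ (p + 1)).range)
    (hn : p ≤ n) : (S ^ n).range = (S ^ p).range := by
  induction n, hn using Nat.le_induction with
  | base => rfl
  | succ n hn ih =>
    refine le_antisymm (range_pow_antitone S (by omega)) ?_
    rw [h]
    rintro _ ⟨x, rfl⟩
    have hx : (S ^ p) x ∈ (S ^ n).range := ih ▸ ⟨x, rfl⟩
    obtain ⟨y, hy⟩ := hx
    refine ⟨y, ?_⟩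
    change (S ^ (n + 1)) y = (S ^ (p + 1)) x
    rw [pow_succ_apply', pow_succ_apply']
    exact congrArg S hy

/-- If the powers of `S` stabilise, some positive power has complementary kernel and range. -/
theorem exists_isCompl_ker_range_pow {S : X →L[ℂ] X} {p q : ℕ}
    (hp : (S ^ p).ker = (S ^ (p + 1)).ker) (hq : (S ^ q).range = (S ^ (q + 1)).range) :
    ∃ n, 0 < n ∧ (S ^ n).ker = (S ^ p).ker ∧ IsCompl (S ^ n).ker (S ^ n).range := by
  -- Both chains are stable from here on; the `+ 1` keeps `n` positive even if `p = q = 0`.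
  set n := p + q + 1
  have hk : (S ^ (n + n)).ker = (S ^ n).ker :=
    (ker_pow_eq_of_le hp (by omega)).trans (ker_pow_eq_of_le hp (by omega)).symm
  have hr : (S ^ (n + n)).range = (S ^ n).range :=
    (range_pow_eq_of_le hq (by omega)).trans (range_pow_eq_of_le hq (by omega)).symm
  refine ⟨n, by omega, ker_pow_eq_of_le hp (by omega), ?_, ?_⟩
  · rw [Submodule.disjoint_def]
    rintro _ hx ⟨y, rfl⟩
    have hy : y ∈ (S ^ (n + n)).ker := by
      rw [LinearMap.mem_ker] at hx ⊢
      exact (pow_add_apply S n n y).trans hx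
    rw [hk] at hy
    exact hy
  · rw [codisjoint_iff, eq_top_iff]
    intro x _
    have hx : (S ^ n) x ∈ (S ^ (n + n)).range := hr ▸ ⟨x, rfl⟩
    obtain ⟨y, hy⟩ := hx
    have hy' : (S ^ n) ((S ^ n) y) = (S ^ n) x := (pow_add_apply S n n y).symm.trans hy
    refine Submodule.mem_sup.2 ⟨x - (S ^ n) y, ?_, (S ^ n) y, ⟨y, rfl⟩, sub_add_cancel _ _⟩
    rw [LinearMap.mem_ker]
    change (S ^ n) (x - (S ^ n) y) = 0
    rw [map_sub, hy', sub_self]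

end Algebra

/-! ### Fredholm and Weyl operators and their powers -/

section Fredholm

variable {X : Type*} [NormedAddCommGroup X] [NormedSpace ℂ X]

theorem isFredholm_pow {S : X →L[ℂ] X} (hS : S.IsFredholm) (n : ℕ) : (S ^ n).IsFredholm := by
  obtain ⟨V, hV⟩ := hS.exists_isQuasiInverse
  refine .of_isQuasiInverse (v := V ^ n) ?_
  induction n with
  | zero => exact (LinearEquiv.refl ℂ X).isQuasiInverse
  | succ n ih =>
    have := ih.comp hV
    rw [pow_succ V, pow_succ' S]
    exact this

theorem index_pow {S : X →L[ℂ] X} (hS : S.IsFredholm) (n : ℕ) :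
    ((S ^ n : X →L[ℂ] X) : X →ₗ[ℂ] X).index = n * (S : X →ₗ[ℂ] X).index := by
  induction n with
  | zero =>
    rw [Nat.cast_zero, zero_mul]
    exact LinearMap.index_id (R := ℂ) (M := X)
  | succ n ih =>
    have h1 := isFredholm_pow hS n
    have := h1.finite_ker
    have := h1.finite_coker
    have := hS.finite_ker
    have := hS.finite_coker
    have h2 := LinearMap.index_comp (f := ((S ^ n : X →L[ℂ] X) : X →ₗ[ℂ] X)) (S : X →ₗ[ℂ] X)
    rw [ih] at h2
    rw [pow_succ']
    refine h2.trans ?_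
    push_cast
    ring

theorem finrank_ker_pow {S : X →L[ℂ] X} (hS : IsWeyl S) (n : ℕ) :
    Module.finrank ℂ (S ^ n).ker = Module.finrank ℂ (X ⧸ (S ^ n).range) := by
  have := index_pow hS.1 n
  rw [hS.2, mul_zero, LinearMap.index_eq_finrank_sub] at this
  exact_mod_cast sub_eq_zero.1 this

/-- Index `0` turns equal kernels into equal finite codimensions, and nested ranges of equal finite
codimension coincide. -/
theorem range_pow_eq_of_ker_pow_eq {S : X →L[ℂ] X} (hS : IsWeyl S) {n : ℕ}
    (h : (S ^ n).ker = (S ^ (n + 1)).ker) : (S ^ n).range = (S ^ (n + 1)).range := by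
  have hle := range_pow_antitone S (Nat.le_succ n)
  have := (isFredholm_pow hS.1 n).finite_coker
  have := (isFredholm_pow hS.1 (n + 1)).finite_coker
  have hf : Module.finrank ℂ (X ⧸ (S ^ (n + 1)).range) = Module.finrank ℂ (X ⧸ (S ^ n).range) := by
    rw [← finrank_ker_pow hS, ← finrank_ker_pow hS, h]
  have hinj := (LinearMap.injective_iff_surjective_of_finrank_eq_finrank hf).2
    (Submodule.factor_surjective hle)
  refine le_antisymm (fun x hx => ?_) hle
  rw [← Submodule.Quotient.mk_eq_zero]
  apply hinj
  rw [map_zero]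
  exact (Submodule.Quotient.mk_eq_zero _).2 hx

theorem ker_pow_eq_of_range_pow_eq {S : X →L[ℂ] X} (hS : IsWeyl S) {n : ℕ}
    (h : (S ^ n).range = (S ^ (n + 1)).range) : (S ^ n).ker = (S ^ (n + 1)).ker := by
  have := (isFredholm_pow hS.1 (n + 1)).finite_ker
  refine Submodule.eq_of_le_of_finrank_eq (fun x hx => ?_) ?_
  · have hx' : (S ^ n) x = 0 := hx
    change (S ^ (n + 1)) x = 0
    rw [pow_succ_apply', hx', map_zero]
  · rw [finrank_ker_pow hS, finrank_ker_pow hS, h]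

/-- Modulo finite rank, `V Sᵐ` is a left inverse of `S` and `Sᵐ V` a right inverse; bracketing their
product around `S` in two ways shows that they agree. -/
theorem isFredholm_of_isFredholm_pow {S : X →L[ℂ] X} {n : ℕ} (hn : 0 < n)
    (h : (S ^ n).IsFredholm) : S.IsFredholm := by
  obtain ⟨V, hl, hr⟩ := h.exists_isQuasiInverse
  obtain ⟨m, rfl⟩ : ∃ m, n = m + 1 := ⟨n - 1, by omega⟩
  have hl' : ((V ∘L (S ^ m)) ∘L S : X →L[ℂ] X).toLinearMap ≈ .id := by
    have : (V ∘L (S ^ m)) ∘L S = V ∘L (S ^ (m + 1)) := by rw [pow_succ]; rfl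
    rw [this]; exact hl
  have hr' : (S ∘L ((S ^ m) ∘L V) : X →L[ℂ] X).toLinearMap ≈ .id := by
    have : S ∘L ((S ^ m) ∘L V) = (S ^ (m + 1)) ∘L V := by rw [pow_succ']; rfl
    rw [this]; exact hr
  refine .of_isQuasiInverse (v := (S ^ m) ∘L V) ⟨?_, hr'⟩
  have h1 : ((V ∘L (S ^ m)) ∘L S ∘L ((S ^ m) ∘L V) : X →L[ℂ] X).toLinearMap
      ≈ ((S ^ m) ∘L V : X →L[ℂ] X).toLinearMap :=
    equiv_comp_right (u := ((S ^ m) ∘L V : X →L[ℂ] X).toLinearMap) hl'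
  have h2 : ((V ∘L (S ^ m)) ∘L S ∘L ((S ^ m) ∘L V) : X →L[ℂ] X).toLinearMap
      ≈ (V ∘L S ^ m : X →L[ℂ] X).toLinearMap :=
    equiv_comp_left (u' := (V ∘L S ^ m : X →L[ℂ] X).toLinearMap) hr'
  have h3 : ((S ^ m) ∘L V : X →L[ℂ] X).toLinearMap ≈ (V ∘L S ^ m : X →L[ℂ] X).toLinearMap :=
    Setoid.trans (Setoid.symm h1) h2
  exact Setoid.trans (equiv_comp_right (u := S.toLinearMap) h3) hl'

/-- An operator whose kernel is finite-dimensional and complementary to its range is Fredholm. -/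
theorem isFredholm_of_isCompl [CompleteSpace X] {A : X →L[ℂ] X} [FiniteDimensional ℂ A.ker]
    (h : IsCompl A.ker A.range) : A.IsFredholm := by
  -- Adding a finite-rank projection onto the kernel makes `A` bijective, so `A` is a finite-rank
  -- perturbation of an isomorphism.
  obtain ⟨P, hP⟩ := Submodule.ClosedComplemented.of_finiteDimensional (𝕜 := ℂ) A.ker
  set Q : X →L[ℂ] X := A.ker.subtypeL ∘L P with hQ
  have hAP : ∀ x, A (P x : X) = 0 := fun x => (P x).2
  have hinj : (A + Q).ker = ⊥ := by
    rw [LinearMap.ker_eq_bot']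
    intro x hx
    have hx' : A x + (P x : X) = 0 := hx
    have h0 : A x = 0 := Submodule.disjoint_def.1 h.disjoint (A x)
      (by rw [eq_neg_of_add_eq_zero_left hx']; exact neg_mem (P x).2) ⟨x, rfl⟩
    have h1 : (P x : X) = x := congrArg Subtype.val (hP ⟨x, h0⟩)
    rw [h0, zero_add, h1] at hx'
    exact hx'
  have hsurj : (A + Q).range = ⊤ := by
    rw [eq_top_iff]
    intro y _
    obtain ⟨k, hk, _, ⟨x, rfl⟩, rfl⟩ := Submodule.mem_sup.1
      (h.sup_eq_top.ge (Submodule.mem_top : y ∈ (⊤ : Submodule ℂ X)))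
    refine ⟨x - P x + k, ?_⟩
    have hk' : A k = 0 := hk
    have h1 : (P k : X) = k := congrArg Subtype.val (hP ⟨k, hk⟩)
    have h2 : (P (P x : X) : X) = P x := congrArg Subtype.val (hP (P x))
    change A (x - P x + k) + (P (x - P x + k) : X) = k + A x
    simp only [map_add, map_sub, hAP, hk', Submodule.coe_add, Submodule.coe_sub, h1, h2]
    abel
  let U := ContinuousLinearEquiv.ofBijective (A + Q) hinj hsurj
  have hUA : A.toLinearMap ≈ U.toLinearEquiv.toLinearMap := by
    rw [equiv_iff_hasFiniteRange]
    have hfr : (P.toLinearMap).HasFiniteRange := LinearMap.HasFiniteRange.of_isNoetherian_rng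
    have heq : A.toLinearMap - U.toLinearEquiv.toLinearMap =
        -(A.ker.subtype ∘ₗ P.toLinearMap) := by
      refine LinearMap.ext fun x => ?_
      change A x - (A x + (P x : X)) = -(P x : X)
      abel
    rw [heq]
    exact (hfr.comp_left A.ker.subtype).neg
  have := U.toLinearEquiv.isQuasiInverse.congr (Setoid.refl _) hUA
  exact .of_isQuasiInverse (v := (U.symm : X →L[ℂ] X)) this

theorem isWeyl_of_stable [CompleteSpace X] {S : X →L[ℂ] X} {p q : ℕ}
    (hp : (S ^ p).ker = (S ^ (p + 1)).ker) (hq : (S ^ q).range = (S ^ (q + 1)).range)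
    (hfin : FiniteDimensional ℂ (S ^ p).ker) : IsWeyl S := by
  obtain ⟨n, hn, hker, hcompl⟩ := exists_isCompl_ker_range_pow hp hq
  have : FiniteDimensional ℂ (S ^ n).ker := hker ▸ hfin
  have hS := isFredholm_of_isFredholm_pow hn (isFredholm_of_isCompl hcompl)
  refine ⟨hS, ?_⟩
  have h0 := index_pow hS n
  rw [LinearMap.index_eq_finrank_sub,
    (Submodule.quotientEquivOfIsCompl _ _ hcompl.symm).finrank_eq, sub_self] at h0
  rcases mul_eq_zero.1 h0.symm with h | h
  · exact absurd h (by exact_mod_cast hn.ne')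
  · exact h

end Fredholm

/-! ### Backward orbits and SVEP -/

section SVEP

variable {X : Type*} [NormedAddCommGroup X] [NormedSpace ℂ X] [CompleteSpace X]

/-- If `x` is the start of a geometrically bounded backward orbit of `T - z I` and lies in its
kernel, then SVEP at `z` forces `x = 0`. -/
theorem eq_zero_of_backward_orbit {T : X →L[ℂ] X} {z : ℂ} (hT : HasSVEPAt T z) {x : ℕ → X} {C : ℝ}
    (hC : 0 < C) (hx0 : shift T z (x 0) = 0) (hx : ∀ n, shift T z (x (n + 1)) = x n)
    (hbound : ∀ n, ‖x n‖ ≤ C ^ n * ‖x 0‖) : x 0 = 0 := by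
  -- On this radius the series `∑ (w - z)ⁿ xₙ` is dominated by `∑ 2⁻ⁿ ‖x₀‖`; it solves the
  -- eigenvalue equation and equals `x₀` at `z`.
  set r : ℝ := 1 / (2 * C) with hr
  have hr0 : 0 < r := by positivity
  set f : ℂ → X := fun w => ∑' n, (w - z) ^ n • x n with hf
  have hsum : Summable fun n : ℕ => (1 / 2 : ℝ) ^ n * ‖x 0‖ :=
    (summable_geometric_of_lt_one (by norm_num) (by norm_num)).mul_right _
  have hterm : ∀ (n : ℕ), ∀ w ∈ Metric.ball z r,
      ‖(w - z) ^ n • x n‖ ≤ (1 / 2 : ℝ) ^ n * ‖x 0‖ := by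
    intro n w hw
    have hw' : ‖w - z‖ ≤ r := (mem_ball_iff_norm.1 hw).le
    rw [norm_smul, norm_pow]
    calc ‖w - z‖ ^ n * ‖x n‖ ≤ r ^ n * (C ^ n * ‖x 0‖) := by
          gcongr
          exact hbound n
      _ = (1 / 2 : ℝ) ^ n * ‖x 0‖ := by
          rw [← mul_assoc, ← mul_pow]
          congr 2
          rw [hr]
          field_simp
  have hsw : ∀ w ∈ Metric.ball z r, Summable fun n : ℕ => (w - z) ^ n • x n := fun w hw =>
    Summable.of_norm_bounded hsum fun n => hterm n w hw
  have hdiff : DifferentiableOn ℂ f (Metric.ball z r) :=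
    Complex.differentiableOn_tsum_of_summable_norm hsum
      (fun n => by fun_prop) Metric.isOpen_ball hterm
  have hzero : ∀ w ∈ Metric.ball z r, shift T w (f w) = 0 := by
    intro w hw
    have h1 : shift T z (f w) = (w - z) • f w := by
      rw [hf, (shift T z).map_tsum (hsw w hw), ← (hsw w hw).tsum_const_smul,
        Summable.tsum_eq_zero_add ((hsw w hw).mapL (shift T z))]
      simp only [map_smul, hx0, hx, smul_zero, zero_add, pow_succ', mul_smul]
    have h2 : shift T w (f w) = shift T z (f w) - (w - z) • f w := by
      simp only [shift, sub_smul, sub_apply, smul_apply,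
        ContinuousLinearMap.id_apply]
      abel
    rw [h2, h1, sub_self]
  have := hT r hr0 f (hdiff.analyticOnNhd Metric.isOpen_ball) hzero z (Metric.mem_ball_self hr0)
  have hfz : f z = x 0 := by
    simp only [hf, sub_self]
    rw [tsum_eq_single 0 (fun n hn => by simp [hn])]
    simp
  rwa [hfz] at this

/-- SVEP at `z` makes `T - z I` injective on every closed subspace that it maps onto itself. -/
theorem disjoint_ker_of_map_eq {T : X →L[ℂ] X} {z : ℂ} (hT : HasSVEPAt T z) {M : Submodule ℂ X}
    (hM : IsClosed (M : Set X)) (hmaps : ∀ x ∈ M, shift T z x ∈ M)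
    (hsurj : ∀ y ∈ M, ∃ x ∈ M, shift T z x = y) {x : X} (hxM : x ∈ M) (hx : shift T z x = 0) :
    x = 0 := by
  have : CompleteSpace M := hM.completeSpace_coe
  let g : M →L[ℂ] M := (shift T z).restrict hmaps
  have hg : Function.Surjective g := fun y => by
    obtain ⟨u, hu, huy⟩ := hsurj y y.2
    exact ⟨⟨u, hu⟩, Subtype.ext huy⟩
  -- The open mapping theorem gives preimages in `M` of controlled norm; iterating the choice yields
  -- the backward orbit.
  obtain ⟨C, hC, hpre⟩ := g.exists_preimage_norm_le hg
  choose v hv hvn using hpre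
  let y : ℕ → M := fun n => v^[n] ⟨x, hxM⟩
  have hy : ∀ n, y (n + 1) = v (y n) := fun n => Function.iterate_succ_apply' _ _ _
  refine eq_zero_of_backward_orbit hT (x := fun n => (y n : X)) hC hx
    (fun n => ?_) (fun n => ?_)
  · rw [hy]
    exact congrArg Subtype.val (hv (y n))
  · induction n with
    | zero => simp
    | succ n ih =>
      change ‖y (n + 1)‖ ≤ _
      rw [hy, pow_succ', mul_assoc]
      exact (hvn _).trans (by gcongr; exact ih)

end SVEP

/-! ### Hyperrange and finite ascent -/

section Ascent

variable {X : Type*} [NormedAddCommGroup X] [NormedSpace ℂ X]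

/-- A Fredholm operator maps its hyperrange onto itself, and its kernel meets the range of some
power only inside the hyperrange. -/
theorem exists_ker_inf_range_le_iInf {S : X →L[ℂ] X} (hS : S.IsFredholm) :
    ∃ m, (∀ x, S x = 0 → x ∈ (S ^ m).range → ∀ n, x ∈ (S ^ n).range) ∧
      ∀ y, (∀ n, y ∈ (S ^ n).range) → ∃ x, (∀ n, x ∈ (S ^ n).range) ∧ S x = y := by
  have := hS.finite_ker
  -- The decreasing chain `N(S) ∩ R(Sⁿ)` lives in a finite-dimensional space, so it stabilises.
  let F : ℕ →o (Submodule ℂ S.ker)ᵒᵈ :=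
    { toFun := fun n => OrderDual.toDual ((S ^ n).range.comap S.ker.subtype)
      monotone' := fun m n h => Submodule.comap_mono (range_pow_antitone S h) }
  obtain ⟨m, hm⟩ := IsArtinian.monotone_stabilizes F
  have key : ∀ x, S x = 0 → x ∈ (S ^ m).range → ∀ n, x ∈ (S ^ n).range := by
    intro x hx hxm n
    rcases le_total m n with h | h
    · have h1 : (⟨x, hx⟩ : S.ker) ∈ (S ^ m).range.comap S.ker.subtype := hxm
      have h2 : (S ^ m).range.comap S.ker.subtype = (S ^ n).range.comap S.ker.subtype := hm n h
      rw [h2] at h1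
      exact h1
    · exact range_pow_antitone S h hxm
  refine ⟨m, key, fun y hy => ?_⟩
  obtain ⟨w, hw⟩ := hy (m + 1)
  have hw' : S ((S ^ m) w) = y := (pow_succ_apply' S m w).symm.trans hw
  refine ⟨(S ^ m) w, fun n => ?_, hw'⟩
  rcases le_total m n with h | h
  · obtain ⟨v, hv⟩ := hy (n + 1)
    have hv' : S ((S ^ n) v) = y := (pow_succ_apply' S n v).symm.trans hv
    -- Two preimages of `y` differ by a kernel vector in `R(Sᵐ)`, hence by an element of the
    -- hyperrange.
    have hmem := key ((S ^ m) w - (S ^ n) v) (by rw [map_sub, hw', hv', sub_self])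
      (sub_mem ⟨w, rfl⟩ (range_pow_antitone S h ⟨v, rfl⟩)) n
    have := add_mem hmem (show (S ^ n) v ∈ (S ^ n).range from ⟨v, rfl⟩)
    rwa [sub_add_cancel] at this
  · exact range_pow_antitone S h ⟨w, rfl⟩

/-- SVEP at `z` forces finite ascent when `T - z I` is Fredholm. -/
theorem exists_ker_pow_eq_of_hasSVEPAt [CompleteSpace X] {T : X →L[ℂ] X} {z : ℂ}
    (hT : HasSVEPAt T z) (hS : (shift T z).IsFredholm) :
    ∃ n : ℕ, (shift T z ^ n).ker = (shift T z ^ (n + 1)).ker := by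
  set S := shift T z with hSdef
  obtain ⟨m, hm, hsurj⟩ := exists_ker_inf_range_le_iInf hS
  let M : Submodule ℂ X := ⨅ n, (S ^ n).range
  have hM : ∀ x, x ∈ M ↔ ∀ n, x ∈ (S ^ n).range := fun x => Submodule.mem_iInf _
  have hclosed : IsClosed (M : Set X) := by
    rw [Submodule.coe_iInf]
    exact isClosed_iInter fun n => (isFredholm_pow hS n).isClosed_range
  have hmaps : ∀ x ∈ M, S x ∈ M := by
    intro x hx
    rw [hM] at hx ⊢
    intro n
    obtain ⟨y, rfl⟩ := hx n
    refine ⟨S y, ?_⟩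
    change (S ^ n) (S y) = S ((S ^ n) y)
    rw [← pow_succ_apply, pow_succ_apply']
  refine ⟨m, le_antisymm (fun x hx => ?_) (fun x hx => ?_)⟩
  · have hx' : (S ^ m) x = 0 := hx
    change (S ^ (m + 1)) x = 0
    rw [pow_succ_apply', hx', map_zero]
  · have hx' : S ((S ^ m) x) = 0 := (pow_succ_apply' S m x).symm.trans hx
    exact disjoint_ker_of_map_eq hT hclosed hmaps
      (fun y hy => by simpa only [hM] using hsurj y ((hM y).1 hy))
      ((hM _).2 (hm _ hx' ⟨x, rfl⟩)) hx'

end Ascent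

/-! ### Passage to the dual operator -/

section Dual

variable {X : Type*} [NormedAddCommGroup X] [NormedSpace ℂ X]

theorem dual_apply (T : X →L[ℂ] X) (φ : StrongDual ℂ X) (x : X) : dual T φ x = φ (T x) := rfl

theorem shift_dual (T : X →L[ℂ] X) (z : ℂ) : shift (dual T) z = dual (shift T z) := by
  ext φ x
  simp [shift, dual_apply]

theorem dual_pow_apply (S : X →L[ℂ] X) (n : ℕ) (φ : StrongDual ℂ X) (x : X) :
    (dual S ^ n) φ x = φ ((S ^ n) x) := by
  induction n generalizing x with
  | zero => rfl
  | succ n ih => rw [pow_succ_apply', dual_apply, ih, pow_succ_apply]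

/-- `F` factors through its finite-dimensional range, so its dual factors through the dual of that
range. -/
theorem hasFiniteRange_dual {F : X →L[ℂ] X} (hF : F.toLinearMap.HasFiniteRange) :
    (dual F).toLinearMap.HasFiniteRange := by
  have : FiniteDimensional ℂ F.range := Submodule.fg_iff_finiteDimensional _ |>.1 hF
  let G : X →L[ℂ] F.range := F.codRestrict F.range fun x => ⟨x, rfl⟩
  let a : StrongDual ℂ X →ₗ[ℂ] Module.Dual ℂ F.range :=
    { toFun := fun φ => φ.toLinearMap ∘ₗ F.range.subtype
      map_add' := fun _ _ => rfl
      map_smul' := fun _ _ => rfl }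
  let b : Module.Dual ℂ F.range →ₗ[ℂ] StrongDual ℂ X :=
    { toFun := fun ψ => (LinearMap.toContinuousLinearMap ψ) ∘L G
      map_add' := fun _ _ => rfl
      map_smul' := fun _ _ => rfl }
  have ha : a.HasFiniteRange := LinearMap.HasFiniteRange.of_isNoetherian_rng
  exact ha.comp_left b

theorem isFredholm_dual {S : X →L[ℂ] X} (hS : S.IsFredholm) : (dual S).IsFredholm := by
  obtain ⟨V, hl, hr⟩ := hS.exists_isQuasiInverse
  have aux : ∀ A B : X →L[ℂ] X, A.toLinearMap ∘ₗ B.toLinearMap ≈ .id →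
      (dual B).toLinearMap ∘ₗ (dual A).toLinearMap ≈ .id := by
    intro A B h
    rw [equiv_iff_hasFiniteRange] at h ⊢
    have heq : (dual B).toLinearMap ∘ₗ (dual A).toLinearMap - .id =
        (dual (A ∘L B - .id ℂ X)).toLinearMap := by
      refine LinearMap.ext fun φ => ContinuousLinearMap.ext fun x => ?_
      exact (map_sub φ (A (B x)) x).symm
    rw [heq]
    exact hasFiniteRange_dual h
  exact .of_isQuasiInverse (v := dual V) ⟨aux _ _ hr, aux _ _ hl⟩

theorem range_pow_eq_of_ker_dual_pow_eq {S : X →L[ℂ] X} (hS : S.IsFredholm) {n : ℕ}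
    (h : (dual S ^ n).ker = (dual S ^ (n + 1)).ker) : (S ^ n).range = (S ^ (n + 1)).range := by
  refine le_antisymm ?_ (range_pow_antitone S n.le_succ)
  rintro _ ⟨x, rfl⟩
  by_contra hx
  have hcl : IsClosed ((S ^ (n + 1)).range : Set X) := (isFredholm_pow hS (n + 1)).isClosed_range
  -- Hahn–Banach on the quotient: `φ` kills `R(Sⁿ⁺¹)` but not `Sⁿ x`, so it separates the two dual
  -- kernels.
  obtain ⟨ψ, hψ⟩ := SeparatingDual.exists_ne_zero (R := ℂ)
    (mt (Submodule.Quotient.mk_eq_zero (S ^ (n + 1)).range).1 hx)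
  let φ : StrongDual ℂ X := ψ ∘L (S ^ (n + 1)).range.mkQL
  have hφ : φ ∈ (dual S ^ (n + 1)).ker := by
    refine ContinuousLinearMap.ext fun y => ?_
    change (dual S ^ (n + 1)) φ y = 0
    rw [dual_pow_apply]
    change ψ (Submodule.Quotient.mk ((S ^ (n + 1)) y)) = 0
    have hy : (Submodule.Quotient.mk ((S ^ (n + 1)) y) : X ⧸ (S ^ (n + 1)).range) = 0 :=
      (Submodule.Quotient.mk_eq_zero _).2 (LinearMap.mem_range_self _ y)
    rw [hy, map_zero]
  rw [← h] at hφ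
  have hφ' : (dual S ^ n) φ = 0 := hφ
  have := dual_pow_apply S n φ x
  rw [hφ'] at this
  exact hψ this.symm

end Dual

/-! ### Finite-rank poles as spectral points outside the Weyl spectrum -/

section Main

variable {X : Type*} [NormedAddCommGroup X] [NormedSpace ℂ X] [CompleteSpace X]

theorem finiteRankPoles_subset (T : X →L[ℂ] X) :
    finiteRankPoles T ⊆ spectrum ℂ T \ weylSpectrum T := by
  rintro z ⟨⟨hz, ha, hd⟩, hfin⟩
  obtain ⟨q, hq⟩ := (descent_lt_top_iff _).1 hd
  exact ⟨hz, not_not.2 (isWeyl_of_stable (ker_pow_ascent ha) hq hfin)⟩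

theorem subset_finiteRankPoles {T : X →L[ℂ] X}
    (hT : HasSVEPOn T (weylSpectrum T)ᶜ ∨ HasSVEPOn (dual T) (weylSpectrum T)ᶜ) :
    spectrum ℂ T \ weylSpectrum T ⊆ finiteRankPoles T := by
  rintro z ⟨hz, hzW⟩
  have hW : IsWeyl (shift T z) := not_not.1 hzW
  obtain ⟨n, hker, hrange⟩ : ∃ n : ℕ, (shift T z ^ n).ker = (shift T z ^ (n + 1)).ker ∧
      (shift T z ^ n).range = (shift T z ^ (n + 1)).range := by
    rcases hT with hT | hT
    · obtain ⟨n, hn⟩ := exists_ker_pow_eq_of_hasSVEPAt (hT z hzW) hW.1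
      exact ⟨n, hn, range_pow_eq_of_ker_pow_eq hW hn⟩
    · have hF := isFredholm_dual hW.1
      rw [← shift_dual] at hF
      obtain ⟨n, hn⟩ := exists_ker_pow_eq_of_hasSVEPAt (hT z hzW) hF
      rw [shift_dual] at hn
      have hr := range_pow_eq_of_ker_dual_pow_eq hW.1 hn
      exact ⟨n, ker_pow_eq_of_range_pow_eq hW hr, hr⟩
  exact ⟨⟨hz, (ascent_lt_top_iff _).2 ⟨n, hker⟩, (descent_lt_top_iff _).2 ⟨n, hrange⟩⟩,
    (isFredholm_pow hW.1 _).finite_ker⟩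

end Main

end WeylType

theorem mainTheorem6 {X : Type*} [NormedAddCommGroup X] [NormedSpace ℂ X] [CompleteSpace X]
    (hX : ¬ FiniteDimensional ℂ X) (T : X →L[ℂ] X)
    (hT : WeylType.HasSVEPOn T (WeylType.weylSpectrum T)ᶜ ∨
      WeylType.HasSVEPOn (WeylType.dual T) (WeylType.weylSpectrum T)ᶜ) :
    WeylType.PropertyZPi T ↔ WeylType.leftPoles T = WeylType.finiteRankPoles T := by
  rw [WeylType.PropertyZPi, (WeylType.subset_finiteRankPoles hT).antisymm
    (WeylType.finiteRankPoles_subset T), eq_comm]
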